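/- **Conventions.** Fix a prime $p$; rings are commutative. For a ring $R$ and $t\in R$, the Tate ring $R[1/t]$ is the localization with the ring topology for which the sets $t^n\cdot\mathrm{im}(R\to R[1/t])$, $n\ge 0$, form a fundamental system of neighbourhoods of $0$. For a Tate ring $A$, $A^\circ$ is the subring of power-bounded elements, with the subspace topology. A pair of definition of $A$ is a pair $(B,(t))$ with $B\subseteq A$ an open subring, $t\in B$, such that the subspace topology on $B$ is the $t$-adic one and $A=B[1/t]$. A ring of integral elements of $A$ is an open subring $A^+\subseteq A^\circ$ that is integrally closed in $A$. The uniform completion of $A$ is the Tate ring $A^{\widehat u}:=\widehat{A^+}[1/t]$, where $(B,(t))$ is a pair of definition of $A$, $A^+\supseteq B$ is a ring of integral elements, and $\widehat{A^+}$ is the $t$-adic completion of $A^+$; it receives a canonical ring map from $A=A^+[1/t]$. (Up to canonical isomorphism it does not depend on the choices; the statement below holds for every choice.) A nonzero ring $S$ is integral perfectoid with perfectoid element $\pi\in S$ if $S$ is $\pi$-adically complete (and separated), $\pi^p$ divides $p$ in $S$, the Frobenius map of $S/pS$ is surjective, and the kernel of Fontaine's map $\theta\colon W(S^\flat)\to S$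 is principal; $\pi$ may be a zero divisor. Given elements $\varpi^{1/p^n}\in S$ $(n\ge 0)$ with $(\varpi^{1/p^{n+1}})^p=\varpi^{1/p^n}$, where $\varpi=\varpi^{1/p^0}$, put $$S_*:=\{s\in S[1/\varpi] : \varpi^{1/p^n}s\in \mathrm{im}(S\to S[1/\varpi])\ \text{for all } n>0\},$$ with the subspace topology of the Tate ring $S[1/\varpi]$. **Proposition 4.1.** Let $A_0$ be a ring and $\pi\in A_0$, endow $A_0$ with the $\pi$-adic topology, and let $A:=A_0[1/\pi]$ be the associated Tate ring. Let $S$ be an $A_0$-algebra in which the image of $\pi$ is nonzero, and assume that $S$ is an integral perfectoid ring with perfectoid element the image of $\pi$. Let $(\varpi^{1/p^n})_{n\ge 0}$ be a compatible sequence of $p$-power roots in $S$ of a unit multiple $\varpi$ of the image of $\pi$, and form $S_*$ with it. Then there is a unique continuous ring homomorphism $f\colon (A^{\widehat u})^\circ\to S_*$ such that the composite $A_0\to (A^{\widehat u})^\circ\xrightarrow{f} S_*$ equals the composite $A_0\to S\to S_*$ of the canonical maps. -/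

import Mathlib

open Topology Filter

noncomputable section

/-! ### Tate rings of the form `R[1/t]` -/

/-- The Tate ring `R[1/t]` attached to a ring `R` and an element `t`. Its topology is defined
below: the subgroups `t ^ n * (R / R[t^∞])`, where `R / R[t^∞]` is the image of `R` in `R[1/t]`,
form a fundamental system of neighbourhoods of `0`. -/
def TateRing (R : Type*) [CommRing R] (t : R) : Type _ := Localization.Away t

namespace TateRing

variable (R : Type*) [CommRing R] (t : R)

instance : CommRing (TateRing R t) := inferInstanceAs (CommRing (Localization.Away t))

instance : Algebra R (TateRing R t) := inferInstanceAs (Algebra R (Localization.Away t))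

instance : IsLocalization.Away t (TateRing R t) :=
  inferInstanceAs (IsLocalization.Away t (Localization.Away t))

/-- The subgroup `t ^ n * (image of R)` of `R[1/t]`. -/
def ball (n : ℕ) : Submodule R (TateRing R t) :=
  Submodule.span R {algebraMap R (TateRing R t) (t ^ n)}

variable {R t}

theorem mem_ball {n : ℕ} {x : TateRing R t} :
    x ∈ ball R t n ↔ ∃ r : R, algebraMap R (TateRing R t) (r * t ^ n) = x := by
  simp [ball, Submodule.mem_span_singleton, Algebra.smul_def]

theorem ball_anti {m n : ℕ} (h : m ≤ n) : ball R t n ≤ ball R t m := by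
  intro x hx
  obtain ⟨r, rfl⟩ := mem_ball.1 hx
  refine mem_ball.2 ⟨r * t ^ (n - m), ?_⟩
  rw [mul_assoc, ← pow_add, Nat.sub_add_cancel h]

theorem exists_pow_mul_eq (a : TateRing R t) : ∃ (k : ℕ) (s : R),
    a * algebraMap R (TateRing R t) (t ^ k) = algebraMap R (TateRing R t) s := by
  obtain ⟨⟨s, ⟨_, k, rfl⟩⟩, h⟩ := IsLocalization.surj (Submonoid.powers t) a
  exact ⟨k, s, h⟩

variable (R t)

theorem submodulesRingBasis : SubmodulesRingBasis (ball R t) where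
  inter i j := ⟨max i j, le_inf (ball_anti (le_max_left _ _)) (ball_anti (le_max_right _ _))⟩
  leftMul a i := by
    obtain ⟨k, s, hs⟩ := exists_pow_mul_eq a
    refine ⟨i + k, ?_⟩
    rintro _ ⟨y, hy, rfl⟩
    obtain ⟨r, rfl⟩ := mem_ball.1 hy
    refine mem_ball.2 ⟨s * r, ?_⟩
    change _ = a * _
    rw [map_mul, map_mul, ← hs]
    simp only [map_mul, map_pow]
    ring
  mul i := by
    refine ⟨i, ?_⟩
    rintro _ ⟨x, hx, y, hy, rfl⟩
    obtain ⟨r, rfl⟩ := mem_ball.1 hx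
    obtain ⟨s, rfl⟩ := mem_ball.1 hy
    refine mem_ball.2 ⟨r * t ^ i * s, ?_⟩
    change _ = _ * _
    rw [← map_mul]
    ring_nf

instance : TopologicalSpace (TateRing R t) := (submodulesRingBasis R t).topology

instance : NonarchimedeanRing (TateRing R t) :=
  (submodulesRingBasis R t).toRing_subgroups_basis.nonarchimedean

theorem hasBasis_nhds_zero :
    (𝓝 (0 : TateRing R t)).HasBasis (fun _ : ℕ => True) fun n => (ball R t n : Set _) :=
  (submodulesRingBasis R t).toRing_subgroups_basis.hasBasis_nhds_zero

end TateRing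

/-! ### Bounded sets and power-bounded elements -/

/-- A subset `B` of a topological ring is bounded if for every neighbourhood `U` of `0` there is a
neighbourhood `V` of `0` with `V * B ⊆ U`. -/
def IsBoundedSubset {A : Type*} [CommRing A] [TopologicalSpace A] (B : Set A) : Prop :=
  ∀ U ∈ 𝓝 (0 : A), ∃ V ∈ 𝓝 (0 : A), ∀ v ∈ V, ∀ b ∈ B, v * b ∈ U

/-- An element is power-bounded if the set of its powers is bounded. -/
def IsPowerBounded {A : Type*} [CommRing A] [TopologicalSpace A] (x : A) : Prop :=
  IsBoundedSubset (Set.range fun n : ℕ => x ^ n)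

/-- The subring `A°` of power-bounded elements. -/
def powerBoundedSubring (A : Type*) [CommRing A] [TopologicalSpace A] [NonarchimedeanRing A] :
    Subring A where
  carrier := {x | IsPowerBounded x}
  one_mem' U hU := ⟨U, hU, by
    rintro v hv _ ⟨n, rfl⟩
    simpa using hv⟩
  mul_mem' := by
    intro x y hx hy U hU
    obtain ⟨V, hV, hVU⟩ := hy U hU
    obtain ⟨W, hW, hWV⟩ := hx V hV
    refine ⟨W, hW, ?_⟩
    rintro w hw _ ⟨n, rfl⟩
    have := hVU _ (hWV w hw _ ⟨n, rfl⟩) _ ⟨n, rfl⟩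
    simpa only [mul_pow, mul_assoc] using this
  zero_mem' U hU := ⟨U, hU, by
    rintro v hv _ ⟨n, rfl⟩
    rcases Nat.eq_zero_or_pos n with rfl | hn
    · simpa using hv
    · simpa [hn.ne'] using mem_of_mem_nhds hU⟩
  add_mem' := by
    intro x y hx hy U hU
    obtain ⟨G, hG⟩ := NonarchimedeanRing.is_nonarchimedean U hU
    obtain ⟨V, hV, hVU⟩ := hy G (G.mem_nhds_zero)
    obtain ⟨W, hW, hWV⟩ := hx V hV
    refine ⟨W, hW, ?_⟩
    rintro w hw _ ⟨n, rfl⟩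
    refine hG ?_
    simp only [add_pow, Finset.mul_sum]
    refine AddSubgroup.sum_mem G.toAddSubgroup fun i _ => ?_
    have := hVU _ (hWV w hw _ ⟨i, rfl⟩) _ ⟨n - i, rfl⟩
    have h2 := nsmul_mem (show w * x ^ i * y ^ (n - i) ∈ G from this) (n.choose i)
    rw [nsmul_eq_mul] at h2
    rwa [show (n.choose i : A) * (w * x ^ i * y ^ (n - i)) =
      w * (x ^ i * y ^ (n - i) * n.choose i) by ring] at h2
  neg_mem' := by
    intro x hx U hU
    obtain ⟨G, hG⟩ := NonarchimedeanRing.is_nonarchimedean U hU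
    obtain ⟨V, hV, hVU⟩ := hx G (G.mem_nhds_zero)
    refine ⟨V, hV, ?_⟩
    rintro v hv _ ⟨n, rfl⟩
    refine hG ?_
    have h : v * x ^ n ∈ G := hVU v hv _ ⟨n, rfl⟩
    rcases neg_one_pow_eq_or A n with h1 | h1
    · simpa only [neg_pow x, h1, one_mul, SetLike.mem_coe] using h
    · simpa only [neg_pow x, h1, neg_mul, one_mul, mul_neg, neg_mem_iff, SetLike.mem_coe] using h

theorem mem_powerBoundedSubring {A : Type*} [CommRing A] [TopologicalSpace A]
    [NonarchimedeanRing A] {x : A} : x ∈ powerBoundedSubring A ↔ IsPowerBounded x := Iff.rfl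

theorem TateRing.isPowerBounded_algebraMap {R : Type*} [CommRing R] {t : R} (r : R) :
    IsPowerBounded (algebraMap R (TateRing R t) r) := by
  intro U hU
  obtain ⟨n, -, hn⟩ := (TateRing.hasBasis_nhds_zero R t).mem_iff.1 hU
  refine ⟨_, (TateRing.hasBasis_nhds_zero R t).mem_of_mem (i := n) trivial, ?_⟩
  rintro v hv _ ⟨k, rfl⟩
  refine hn ?_
  obtain ⟨s, rfl⟩ := TateRing.mem_ball.1 hv
  refine TateRing.mem_ball.2 ⟨s * r ^ k, ?_⟩
  simp only [map_mul, map_pow]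
  ring

/-! ### Uniform completion -/

/-- `(A0, (t))` is a pair of definition of the topological ring `A`: the subring `A0` is open, its
relative topology is the `t`-adic one, and `A = A0[1/t]`. -/
structure IsPairOfDefinition {A : Type*} [CommRing A] [TopologicalSpace A]
    (A0 : Subring A) (t : A0) : Prop where
  isOpen : IsOpen (A0 : Set A)
  isAdic : IsAdic (Ideal.span {t})
  isLocalization : IsLocalization.Away t A

/-- Rings of integral elements: open, integrally closed subrings of power-bounded elements. -/
structure IsRingOfIntegralElements {A : Type*} [CommRing A] [TopologicalSpace A]
    (Aplus : Subring A) : Prop where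
  isOpen : IsOpen (Aplus : Set A)
  mem_of_isIntegral : ∀ x : A, IsIntegral Aplus x → x ∈ Aplus
  isPowerBounded : ∀ x ∈ Aplus, IsPowerBounded x

/-- The choices entering the construction of the uniform completion of a Tate ring `A`: a pair of
definition `(A0, (t))` and a ring of integral elements `Aplus` containing `A0`. -/
structure UniformizationData (A : Type*) [CommRing A] [TopologicalSpace A] where
  A0 : Subring A
  t : A0
  isPairOfDefinition : IsPairOfDefinition A0 t
  Aplus : Subring A
  isRingOfIntegralElements : IsRingOfIntegralElements Aplus
  le : A0 ≤ Aplus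

namespace UniformizationData

variable {A : Type*} [CommRing A] [TopologicalSpace A] (D : UniformizationData A)

/-- The element `t`, as an element of `Aplus`. -/
def tPlus : D.Aplus := Subring.inclusion D.le D.t

/-- The `t`-adic completion of `Aplus`. -/
abbrev Completion : Type _ := AdicCompletion (Ideal.span {D.tPlus}) D.Aplus

/-- The uniform completion of `A`: the Tate ring `R[1/t]`, where `R` is the `t`-adic completion
of `Aplus`. -/
abbrev UniformCompletion : Type _ :=
  TateRing D.Completion (algebraMap D.Aplus D.Completion D.tPlus)

theorem isLocalization_plus : IsLocalization.Away D.tPlus A := by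
  have := D.isPairOfDefinition.isLocalization
  have hu : IsUnit (D.t : A) := IsLocalization.Away.algebraMap_isUnit (S := A) D.t
  refine { map_units := ?_, surj := ?_, exists_of_eq := ?_ }
  · rintro ⟨_, n, rfl⟩
    exact (hu.pow n)
  · intro a
    obtain ⟨⟨s, ⟨_, n, rfl⟩⟩, h⟩ := IsLocalization.surj (Submonoid.powers D.t) a
    exact ⟨(Subring.inclusion D.le s, ⟨_, n, rfl⟩), h⟩
  · intro x y h
    exact ⟨1, by rw [Subtype.ext h]⟩

/-- The ring map `Aplus → R → R[1/t]`, with `R` the `t`-adic completion of `Aplus`. -/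
def plusMap : D.Aplus →+* D.UniformCompletion :=
  (algebraMap D.Completion D.UniformCompletion).comp (algebraMap D.Aplus D.Completion)

theorem isUnit_plusMap : IsUnit (D.plusMap D.tPlus) :=
  IsLocalization.Away.algebraMap_isUnit (S := D.UniformCompletion)
    (algebraMap D.Aplus D.Completion D.tPlus)

/-- The canonical map from `A = Aplus[1/t]` to its uniform completion. -/
def toUniformCompletion : A →+* D.UniformCompletion :=
  haveI := D.isLocalization_plus
  IsLocalization.Away.lift (S := A) D.tPlus D.isUnit_plusMap

theorem toUniformCompletion_coe (x : D.Aplus) : D.toUniformCompletion (x : A) = D.plusMap x := by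
  have := D.isLocalization_plus
  exact IsLocalization.Away.lift_eq (S := A) D.tPlus D.isUnit_plusMap x

theorem exists_pow_mem {V : Set A} (hV : V ∈ 𝓝 (0 : A)) : ∃ n : ℕ, (D.tPlus : A) ^ n ∈ V := by
  have h : ((↑) : D.A0 → A) ⁻¹' V ∈ 𝓝 (0 : D.A0) :=
    continuous_subtype_val.continuousAt.preimage_mem_nhds (by simpa using hV)
  obtain ⟨n, -, hn⟩ := D.isPairOfDefinition.isAdic.hasBasis_nhds_zero.mem_iff.1 h
  exact ⟨n, hn (Ideal.pow_mem_pow (Ideal.mem_span_singleton_self D.t) n)⟩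

theorem isPowerBounded_toUniformCompletion {x : A} (hx : IsPowerBounded x) :
    IsPowerBounded (D.toUniformCompletion x) := by
  obtain ⟨V, hV, hVx⟩ := hx D.Aplus
    (D.isRingOfIntegralElements.isOpen.mem_nhds D.Aplus.zero_mem)
  obtain ⟨n, hn⟩ := D.exists_pow_mem hV
  intro U hU
  obtain ⟨m, -, hm⟩ := (TateRing.hasBasis_nhds_zero _ _).mem_iff.1 hU
  refine ⟨_, (TateRing.hasBasis_nhds_zero _ _).mem_of_mem (i := m + n) trivial, ?_⟩
  rintro v hv _ ⟨k, rfl⟩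
  refine hm ?_
  obtain ⟨s, rfl⟩ := TateRing.mem_ball.1 hv
  let y : D.Aplus := ⟨(D.tPlus : A) ^ n * x ^ k, hVx _ hn _ ⟨k, rfl⟩⟩
  have hy : D.plusMap D.tPlus ^ n * D.toUniformCompletion x ^ k = D.plusMap y := by
    rw [← D.toUniformCompletion_coe, ← D.toUniformCompletion_coe, ← map_pow, ← map_pow, ← map_mul]
  refine TateRing.mem_ball.2 ⟨s * algebraMap D.Aplus D.Completion y, ?_⟩
  have e : ∀ z : D.Aplus, algebraMap D.Completion D.UniformCompletion
      (algebraMap D.Aplus D.Completion z) = D.plusMap z := fun _ => rfl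
  simp only [map_mul, map_pow, e, ← hy]
  ring

end UniformizationData

/-- The canonical map `A₀ → (uniform completion of A₀[1/π])°`. -/
def toPowerBoundedUniformCompletion {A₀ : Type*} [CommRing A₀] {π : A₀}
    (D : UniformizationData (TateRing A₀ π)) : A₀ →+* powerBoundedSubring D.UniformCompletion :=
  (D.toUniformCompletion.comp (algebraMap A₀ (TateRing A₀ π))).codRestrict
    (powerBoundedSubring D.UniformCompletion) fun a =>
      D.isPowerBounded_toUniformCompletion (TateRing.isPowerBounded_algebraMap a)

/-! ### Integral perfectoid rings -/

/-- The first condition in the definition of an integral perfectoid ring: `S` is nonzero and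
`π`-adically complete (and separated), and `π ^ p` divides `p` in `S`. -/
structure IsPerfectoidTopology (p : ℕ) {S : Type*} [CommRing S] (π : S) : Prop where
  nontrivial : Nontrivial S
  isAdicComplete : IsAdicComplete (Ideal.span {π}) S
  pow_dvd : π ^ p ∣ (p : S)

namespace IsPerfectoidTopology

variable {p : ℕ} [hp : Fact p.Prime] {S : Type*} [CommRing S] {π : S}

theorem dvd (h : IsPerfectoidTopology p π) : π ∣ (p : S) :=
  (dvd_pow_self π hp.out.ne_zero).trans h.pow_dvd

theorem not_isUnit (h : IsPerfectoidTopology p π) : ¬ IsUnit (p : S) := by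
  intro hu
  have := h.nontrivial
  have := h.isAdicComplete
  have h1 : π ∈ (⊥ : Ideal S).jacobson :=
    IsAdicComplete.le_jacobson_bot (Ideal.span {π}) (Ideal.mem_span_singleton_self π)
  have h2 : (⊥ : Ideal S).jacobson = ⊤ :=
    Ideal.eq_top_of_isUnit_mem _ h1 (isUnit_of_dvd_unit h.dvd hu)
  exact bot_ne_top (Ideal.jacobson_eq_top_iff.1 h2)

theorem smodEq_iff (x : S) (n : ℕ) (a b : S) :
    a ≡ b [SMOD (Ideal.span {x} ^ n • ⊤ : Submodule S S)] ↔ x ^ n ∣ a - b := by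
  rw [SModEq.sub_mem, smul_eq_mul, Ideal.mul_top, Ideal.span_singleton_pow,
    Ideal.mem_span_singleton]

/-- The ring `S` is also `p`-adically complete, so that Fontaine's map `θ` is defined. -/
theorem isAdicComplete_p (h : IsPerfectoidTopology p π) :
    IsAdicComplete (Ideal.span {(p : S)}) S := by
  have hc := h.isAdicComplete
  have hd : ∀ n, π ^ n ∣ (p : S) ^ n := fun n => pow_dvd_pow_of_dvd h.dvd n
  have haus : ∀ x : S, (∀ n, π ^ n ∣ x) → x = 0 := fun x hx =>
    hc.haus' x fun n => (smodEq_iff π n x 0).2 (by simpa using hx n)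
  refine { haus' := fun x hx => haus x fun n => ?_, prec' := fun f hf => ?_ }
  · exact (hd n).trans (by simpa using (smodEq_iff (p : S) n x 0).1 (hx n))
  · have hf' : ∀ n, ∃ g, f (n + 1) - f n = (p : S) ^ n * g := fun n => by
      have := (smodEq_iff (p : S) n _ _).1 (hf (Nat.le_succ n))
      rw [dvd_sub_comm] at this
      exact this
    choose g hg using hf'
    let s : ℕ → ℕ → S := fun n m => ∑ k ∈ Finset.range m, (p : S) ^ k * g (n + k)
    have hs : ∀ n m, (p : S) ^ n * s n m = f (n + m) - f n := by
      intro n m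
      induction m with
      | zero => simp [s]
      | succ m ih =>
        have e : s n (m + 1) = s n m + (p : S) ^ m * g (n + m) := Finset.sum_range_succ _ _
        rw [e, mul_add, ih, ← mul_assoc, ← pow_add, ← hg, ← add_assoc]
        ring
    have hl : ∀ n, ∃ l, ∀ m, π ^ m ∣ s n m - l := by
      intro n
      obtain ⟨l, hl⟩ := hc.prec' (f := s n) (by
        intro a b hab
        rw [smodEq_iff, dvd_sub_comm]
        change _ ∣ (∑ k ∈ Finset.range b, _) - ∑ k ∈ Finset.range a, _
        rw [← Finset.sum_range_add_sum_Ico _ hab, add_sub_cancel_left]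
        refine Finset.dvd_sum fun k hk => ?_
        exact ((pow_dvd_pow π (Finset.mem_Ico.1 hk).1).trans (hd k)).mul_right _)
      exact ⟨l, fun m => (smodEq_iff _ _ _ _).1 (hl m)⟩
    choose l hl using hl
    refine ⟨f 0 + l 0, fun n => ?_⟩
    rw [smodEq_iff, dvd_sub_comm]
    refine ⟨l n, ?_⟩
    rw [← sub_eq_zero]
    refine haus _ fun m => ?_
    have h1 : π ^ m ∣ s 0 (n + m) - l 0 := (pow_dvd_pow π (Nat.le_add_left m n)).trans (hl 0 _)
    have h2 : π ^ m ∣ (p : S) ^ n * (s n m - l n) := (hl n m).mul_left _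
    have h3 := hs 0 (n + m)
    have h4 := hs n m
    simp only [pow_zero, one_mul, zero_add] at h3
    have : f 0 + l 0 - f n - (p : S) ^ n * l n
        = (p : S) ^ n * (s n m - l n) - (s 0 (n + m) - l 0) := by
      rw [mul_sub, h4, h3]; ring
    rw [this]
    exact dvd_sub h2 h1

end IsPerfectoidTopology

/-- `S` is an integral perfectoid ring and `π` is a perfectoid element of `S`: the ring `S` is
nonzero and `π`-adically complete, `π ^ p` divides `p`, the Frobenius of `S / p` is surjective, and
the kernel of Fontaine's map `θ : W(S^♭) → S` is principal. -/
structure IsIntegralPerfectoid (p : ℕ) [Fact p.Prime] {S : Type*} [CommRing S] (π : S) : Prop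
    extends IsPerfectoidTopology p π where
  frobenius_surjective :
    haveI : Fact (¬ IsUnit (p : S)) := ⟨toIsPerfectoidTopology.not_isUnit⟩
    Function.Surjective (frobenius (ModP S p) p)
  isPrincipal_ker :
    haveI : Fact (¬ IsUnit (p : S)) := ⟨toIsPerfectoidTopology.not_isUnit⟩
    haveI := toIsPerfectoidTopology.isAdicComplete_p
    (RingHom.ker (WittVector.fontaineTheta S p)).IsPrincipal

/-! ### Almost elements -/

/-- `ϖ` is a compatible sequence of `p`-power roots of `ϖ 0`: `ϖ n` is `(ϖ 0) ^ (1 / p ^ n)`. -/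
def IsPowerRootSequence (p : ℕ) {S : Type*} [CommRing S] (ϖ : ℕ → S) : Prop :=
  ∀ n, ϖ (n + 1) ^ p = ϖ n

/-- The ring of almost elements `S_*` of `S`, with respect to a compatible sequence `ϖ` of
`p`-power roots: all `s` in `S[1/ϖ₀]` such that `ϖ n * s` lies in the image of `S` for all `n > 0`.
It carries the subspace topology of the Tate ring `S[1/ϖ₀]`. -/
def almostElements (p : ℕ) [hp : Fact p.Prime] {S : Type*} [CommRing S] (ϖ : ℕ → S)
    (hϖ : IsPowerRootSequence p ϖ) : Subring (TateRing S (ϖ 0)) where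
  carrier := {s | ∀ n : ℕ, 0 < n → algebraMap S (TateRing S (ϖ 0)) (ϖ n) * s ∈
    (algebraMap S (TateRing S (ϖ 0))).range}
  one_mem' n _ := by rw [mul_one]; exact ⟨_, rfl⟩
  zero_mem' n _ := by rw [mul_zero]; exact zero_mem _
  add_mem' hx hy n hn := by rw [mul_add]; exact add_mem (hx n hn) (hy n hn)
  neg_mem' hx n hn := by rw [mul_neg]; exact neg_mem (hx n hn)
  mul_mem' := by
    intro x y hx hy n hn
    obtain ⟨q, hq⟩ := Nat.exists_eq_add_of_le hp.out.two_le
    have h := mul_mem (mul_mem (hx (n + 1) n.succ_pos) (hy (n + 1) n.succ_pos))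
      (show algebraMap S (TateRing S (ϖ 0)) (ϖ (n + 1) ^ q) ∈
        (algebraMap S (TateRing S (ϖ 0))).range from ⟨_, rfl⟩)
    convert h using 1
    rw [← hϖ n, hq]
    simp only [map_pow]
    ring

/-- The canonical map `S → S_*`. -/
def toAlmostElements (p : ℕ) [Fact p.Prime] {S : Type*} [CommRing S] (ϖ : ℕ → S)
    (hϖ : IsPowerRootSequence p ϖ) : S →+* almostElements p ϖ hϖ :=
  (algebraMap S (TateRing S (ϖ 0))).codRestrict (almostElements p ϖ hϖ) fun s n _ =>
    ⟨ϖ n * s, map_mul _ _ _⟩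

end

/-! The map `A₀[1/π] → S[1/ϖ]` is forced, since `π` becomes invertible. Power-boundedness of `x`
says that all powers of `x` share one denominator. So two facts suffice: an element of `S[1/ϖ]`
whose powers have a common denominator lies in `S_*`
(`IsIntegralPerfectoid.mem_almostElements_of_bounded`), and `S_*` is `ϖ`-adically complete. Then
`A⁺` maps to `S_*`, the map extends to the completion of `A⁺` and, inverting `t`, to the uniform
completion; the first fact, used again, puts the power-bounded elements in `S_*`. Uniqueness follows
from density of `A⁺` in its completion and separatedness of `S_*`.

Both facts rest on the torsion of `S`: whatever a power of `ϖ` kills is killed by every `ϖ^(1/p^n)`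
(`IsIntegralPerfectoid.root_mul_eq_zero`). The first also needs that `c ^ p ∣ s ^ p` implies `c ∣ s`
for `c = ϖ^(1/p^n)` (`IsIntegralPerfectoid.root_dvd`), which makes `S_*` closed under `p`-th roots,
so that a common denominator can be made negligible by extracting a high `p`-power root. These two
properties of `S` come from `W(S^♭)`: the kernel of `θ` is generated by some `p - [a]^p β`, with `a`
the element of the perfect ring `S^♭` given by `ϖ`, while `W(S^♭)` is reduced and `p` is regular in
it. -/

noncomputable section

section FontaineTheta

open WittVector

/-! ### Consequences of principality of the kernel of Fontaine's map -/

/-! ### Witt vectors over a perfect ring of characteristic `p`. -/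

section Witt

variable {p : ℕ} [Fact p.Prime] {k : Type*} [CommRing k] [CharP k p] [PerfectRing k p]

theorem WittVector.p_dvd_iff (x : WittVector p k) : (p : WittVector p k) ∣ x ↔ x.coeff 0 = 0 := by
  rw [← Ideal.mem_span_singleton, mem_span_p_iff_coeff_zero_eq_zero]

theorem WittVector.eq_of_p_mul_eq {x y : WittVector p k} (h : p * x = p * y) : x = y := by
  rw [← sub_eq_zero]
  apply eq_zero_of_p_mul_eq_zero
  linear_combination h

theorem PerfectRing.isReduced (p : ℕ) [Fact p.Prime] (k : Type*) [CommRing k] [CharP k p]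
    [PerfectRing k p] : IsReduced k := by
  refine ⟨fun x ⟨n, hn⟩ => ?_⟩
  have h : x ^ p ^ n = 0 :=
    pow_eq_zero_of_le (Nat.lt_pow_self (Fact.out : p.Prime).one_lt).le hn
  exact (iterateFrobeniusEquiv k p n).injective (by
    rw [map_zero]; simpa [iterateFrobenius_def] using h)

/-- The zeroth coefficient of a nilpotent `x` is nilpotent, hence zero, so `p` divides `x`. As `p`
is regular, the quotient is again nilpotent; iterating, `x` is divisible by every power of `p`. -/
theorem WittVector.isReduced_of_perfectRing : IsReduced (WittVector p k) := by
  have : IsReduced k := PerfectRing.isReduced p k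
  refine ⟨fun x ⟨n, hn⟩ => ?_⟩
  have key : ∀ m : ℕ, ∃ y : WittVector p k, x = p ^ m * y ∧ y ^ n = 0 := by
    intro m
    induction m with
    | zero => exact ⟨x, by simp, hn⟩
    | succ m ih =>
      obtain ⟨y, rfl, hy⟩ := ih
      have h0 : y.coeff 0 = 0 := by
        have : constantCoeff y ^ n = 0 := by rw [← map_pow, hy, map_zero]
        exact IsNilpotent.eq_zero ⟨n, this⟩
      obtain ⟨z, rfl⟩ := (p_dvd_iff y).2 h0
      refine ⟨z, by ring, ?_⟩
      have hpow : ∀ i : ℕ, ∀ w : WittVector p k, (p : WittVector p k) ^ i * w = 0 → w = 0 := by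
        intro i
        induction i with
        | zero => intro w hw; simpa using hw
        | succ i ih =>
          intro w hw
          refine eq_of_p_mul_eq (ih _ ?_ |>.trans (mul_zero _).symm)
          rw [← hw]; ring
      exact hpow n _ (by rw [← mul_pow, hy])
  ext m
  obtain ⟨y, hy, -⟩ := key (m + 1)
  rw [zero_coeff]
  exact (mem_span_p_pow_iff_le_coeff_eq_zero x (m + 1)).1
    (Ideal.mem_span_singleton.2 ⟨y, hy⟩) m m.lt_succ_self

/-- By `p`-adic completeness `p` lies in the Jacobson radical, so units lift from the residue ring.
-/
theorem WittVector.isUnit_of_isUnit_coeff_zero {x : WittVector p k} (hx : IsUnit (x.coeff 0)) :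
    IsUnit x := by
  obtain ⟨b, hb⟩ := hx.exists_right_inv
  have h : (p : WittVector p k) ∣ x * teichmuller p b - 1 := by
    rw [p_dvd_iff]
    change constantCoeff (x * teichmuller p b - 1) = 0
    rw [map_sub, map_mul, map_one, sub_eq_zero]
    simpa using hb
  have h1 : x * teichmuller p b - 1 ∈ (⊥ : Ideal (WittVector p k)).jacobson :=
    IsAdicComplete.le_jacobson_bot (Ideal.span {(p : WittVector p k)})
      (Ideal.mem_span_singleton.2 h)
  have h2 := (Ideal.mem_jacobson_bot.1 h1) 1
  rw [mul_one, sub_add_cancel] at h2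
  exact isUnit_of_mul_isUnit_left h2

end Witt

/-! ### The tilt -/

theorem IsPowerRootSequence.pow {p : ℕ} {S : Type*} [CommRing S] {ϖ : ℕ → S} (hϖ : IsPowerRootSequence p ϖ) (n i : ℕ) :
    ϖ (n + i) ^ p ^ i = ϖ n := by
  induction i with
  | zero => simp
  | succ i ih => rw [pow_succ', pow_mul, ← add_assoc, hϖ, ih]

section Tilt

variable {p : ℕ} [hp : Fact p.Prime] {S : Type*} [CommRing S] [Fact (¬ IsUnit (p : S))]

/-- Every coefficient is a `p`-power root of the zeroth, hence a unit; uniqueness of inverses makes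
the inverses a compatible sequence. -/
theorem PreTilt.isUnit_of_isUnit_coeff_zero {x : PreTilt S p} (hx : IsUnit (PreTilt.coeff 0 x)) :
    IsUnit x := by
  have hn : ∀ n, IsUnit (PreTilt.coeff n x) := by
    intro n
    induction n with
    | zero => exact hx
    | succ n ih =>
      rw [← PreTilt.coeff_pow_p] at ih
      exact (isUnit_pow_iff hp.out.ne_zero).1 ih
  choose b hb using fun n => (hn n).exists_right_inv
  have hb' : ∀ n, b (n + 1) ^ p = b n := by
    intro n
    have h1 : PreTilt.coeff n x * b (n + 1) ^ p = 1 := by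
      rw [← PreTilt.coeff_pow_p, ← mul_pow, hb, one_pow]
    exact (hn n).mul_left_cancel (h1.trans (hb n).symm)
  refine IsUnit.of_mul_eq_one (⟨b, hb'⟩ : Perfection (ModP S p) p) ?_
  exact Perfection.ext fun n => (map_mul (PreTilt.coeff n) x _).trans
    ((hb n).trans (map_one (PreTilt.coeff n)).symm)

/-- The element of the tilt attached to the shifted sequence `ϖ n, ϖ (n + 1), …`. -/
def tiltOfSequence {ϖ : ℕ → S} (hϖ : IsPowerRootSequence p ϖ) (n : ℕ) : PreTilt S p :=
  (⟨fun i => Ideal.Quotient.mk _ (ϖ (n + i)), fun i => by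
    rw [← map_pow, ← add_assoc, hϖ]⟩ : Perfection (ModP S p) p)

theorem coeff_tiltOfSequence {ϖ : ℕ → S} (hϖ : IsPowerRootSequence p ϖ) (n i : ℕ) :
    PreTilt.coeff i (tiltOfSequence hϖ n) = Ideal.Quotient.mk _ (ϖ (n + i)) := rfl

theorem tiltOfSequence_pow {ϖ : ℕ → S} (hϖ : IsPowerRootSequence p ϖ) (n i : ℕ) :
    tiltOfSequence hϖ (n + i) ^ p ^ i = tiltOfSequence hϖ n := by
  refine Perfection.ext fun j => ?_
  change PreTilt.coeff j (_ ^ p ^ i) = PreTilt.coeff j _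
  rw [map_pow, coeff_tiltOfSequence, coeff_tiltOfSequence, ← map_pow, add_right_comm, hϖ.pow]

variable [IsAdicComplete (Ideal.span {(p : S)}) S]

/-- The two sides agree modulo `p` at every level `n + m`; raising to the `p ^ m`-th power improves
this to a congruence modulo `p ^ (m + 1)` at level `n`. -/
theorem untilt_tiltOfSequence {ϖ : ℕ → S} (hϖ : IsPowerRootSequence p ϖ) (n : ℕ) :
    (tiltOfSequence hϖ n).untilt = ϖ n := by
  rw [IsHausdorff.eq_iff_smodEq (I := Ideal.span {(p : S)})]
  intro m
  rw [IsPerfectoidTopology.smodEq_iff]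
  have h1 : (p : S) ∣ (tiltOfSequence hϖ (n + m)).untilt - ϖ (n + m) := by
    rw [← Ideal.mem_span_singleton, ← Ideal.Quotient.eq, PreTilt.mk_untilt_eq_coeff_zero]
    rfl
  have h2 := dvd_sub_pow_of_dvd_sub h1 m
  rw [← map_pow, tiltOfSequence_pow, hϖ.pow] at h2
  exact (pow_dvd_pow _ m.le_succ).trans h2

theorem fontaineTheta_teichmuller_tiltOfSequence {ϖ : ℕ → S} (hϖ : IsPowerRootSequence p ϖ)
    (n : ℕ) : fontaineTheta S p (teichmuller p (tiltOfSequence hϖ n)) = ϖ n := by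
  rw [fontaineTheta_teichmuller, untilt_tiltOfSequence]

end Tilt

/-! ### The distinguished generator of the kernel of `θ`, and arithmetic of `S` read off in
`W(S^♭)`. -/

section Perfectoid

variable {p : ℕ} [hp : Fact p.Prime] {S : Type*} [CommRing S]

theorem IsPerfectoidTopology.mem_of_isMaximal {p : ℕ} {S : Type*} [CommRing S] {π : S} (h : IsPerfectoidTopology p π)
    (m : Ideal S) [m.IsMaximal] : π ∈ m := by
  have := h.isAdicComplete
  have h1 : π ∈ (⊥ : Ideal S).jacobson :=
    IsAdicComplete.le_jacobson_bot (Ideal.span {π}) (Ideal.mem_span_singleton_self π)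
  exact (Ideal.mem_sInf.1 h1) ⟨bot_le, inferInstance⟩

variable [Fact (¬ IsUnit (p : S))] [IsAdicComplete (Ideal.span {(p : S)}) S]

/-- If a Witt vector `v` divides an element of the form `p - [a] * β`, with cofactor in the kernel
of `θ` and `θ [a]` topologically nilpotent, then `v` is a unit. -/
theorem isUnit_of_dvd_distinguished {π : S} (h : IsPerfectoidTopology p π)
    {a : PreTilt S p} {ξ v β : WittVector p (PreTilt S p)}
    (ha : π ∣ a.untilt) (hξ : fontaineTheta S p ξ = 0)
    (hv : p - teichmuller p a * β = ξ * v) : IsUnit v := by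
  have hu : IsUnit (fontaineTheta S p v) := by
    by_contra hn
    obtain ⟨m, hm, hvm⟩ := exists_max_ideal_of_mem_nonunits hn
    have hpm : (p : S) ∈ m := m.mem_of_dvd h.dvd (h.mem_of_isMaximal m)
    have hle : Ideal.span {(p : S)} ≤ m := (Ideal.span_singleton_le_iff_mem _).2 hpm
    let f : PreTilt S p →+* S ⧸ m := (Ideal.Quotient.factor hle).comp (PreTilt.coeff 0)
    have hchar : CharP (S ⧸ m) p := by
      have := Ideal.Quotient.nontrivial_iff.2 hm.ne_top
      rw [CharP.charP_iff_prime_eq_zero hp.out, ← map_natCast (Ideal.Quotient.mk m)]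
      exact Ideal.Quotient.eq_zero_iff_mem.2 hpm
    have hf : ∀ x, f (x.coeff 0) = Ideal.Quotient.mk m (fontaineTheta S p x) := by
      intro x
      change Ideal.Quotient.factor hle (PreTilt.coeff 0 _) = _
      rw [← mk_fontaineTheta]; rfl
    have hz : ∀ x, fontaineTheta S p x ∈ m → (WittVector.map f x).coeff 0 = 0 := by
      intro x hx
      rw [WittVector.map_coeff, hf]
      exact Ideal.Quotient.eq_zero_iff_mem.2 hx
    have hfa : WittVector.map f (teichmuller p a) = 0 := by
      have := hf (teichmuller p a)
      rw [teichmuller_coeff_zero] at this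
      rw [map_teichmuller, this, fontaineTheta_teichmuller,
        Ideal.Quotient.eq_zero_iff_mem.2 (m.mem_of_dvd ha (h.mem_of_isMaximal m)),
        teichmuller_zero]
    obtain ⟨y, hy⟩ := (p_dvd_iff (ξ - teichmuller p (ξ.coeff 0))).2 (by
      change constantCoeff (ξ - teichmuller p (ξ.coeff 0)) = 0
      rw [map_sub, sub_eq_zero]
      exact (teichmuller_coeff_zero p _).symm)
    have hξ' : WittVector.map f ξ = p * WittVector.map f y := by
      rw [eq_add_of_sub_eq hy, map_add, map_mul, map_natCast, map_teichmuller, hf, hξ, map_zero,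
        teichmuller_zero, add_zero]
    have hv' := congrArg (WittVector.map f) hv
    rw [map_sub, map_mul, hfa, zero_mul, sub_zero, map_natCast, map_mul, hξ', mul_assoc] at hv'
    -- The equation reads `p = p * (y * v)` with `v` of zeroth coefficient zero. Coefficient 1 is
    -- `1` on the left and `(y₀ * v₀) ^ p = 0` on the right.
    have h1 := congrArg (fun w => w.coeff 1) hv'
    simp only [coeff_p_one] at h1
    rw [mul_comm, mul_charP_coeff_succ, mul_coeff_zero, hz v hvm, mul_zero,
      zero_pow hp.out.ne_zero] at h1
    exact one_ne_zero h1
  refine isUnit_of_isUnit_coeff_zero (PreTilt.isUnit_of_isUnit_coeff_zero ?_)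
  rw [← mk_fontaineTheta]
  exact hu.map _

/-- If `θ` is surjective with principal kernel, the kernel is generated by an element
`p - [a] ^ p * β`, where `a` is the element of the tilt attached to `ϖ`. -/
theorem exists_distinguished_generator {π : S} (h : IsPerfectoidTopology p π)
    (hθ : Function.Surjective (fontaineTheta S p))
    (hker : (RingHom.ker (fontaineTheta S p)).IsPrincipal)
    {ϖ : ℕ → S} (hϖ : IsPowerRootSequence p ϖ) (hϖπ : Associated (ϖ 0) π) :
    ∃ β : WittVector p (PreTilt S p), ∀ x, fontaineTheta S p x = 0 ↔
      p - teichmuller p (tiltOfSequence hϖ 0) ^ p * β ∣ x := by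
  obtain ⟨s, hs⟩ : ϖ 0 ^ p ∣ (p : S) := (pow_dvd_pow_of_dvd hϖπ.dvd p).trans h.pow_dvd
  obtain ⟨β, rfl⟩ := hθ s
  have h0 : fontaineTheta S p (p - teichmuller p (tiltOfSequence hϖ 0) ^ p * β) = 0 := by
    rw [map_sub, map_mul, map_pow, fontaineTheta_teichmuller_tiltOfSequence, map_natCast, ← hs,
      sub_self]
  obtain ⟨ξ, hξ⟩ := hker
  have hξ' : ∀ x, fontaineTheta S p x = 0 ↔ ξ ∣ x := fun x => by
    rw [← RingHom.mem_ker, hξ]; exact Ideal.mem_span_singleton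
  obtain ⟨v, hv⟩ := (hξ' _).1 h0
  have hvu : IsUnit v := by
    -- One factor `[a]` is split off `[a] ^ p`, the remaining ones going into the cofactor.
    obtain ⟨q, hq⟩ := Nat.exists_eq_succ_of_ne_zero hp.out.ne_zero
    refine isUnit_of_dvd_distinguished h (a := tiltOfSequence hϖ 0) (ξ := ξ)
      (β := teichmuller p (tiltOfSequence hϖ 0) ^ q * β) ?_ ((hξ' ξ).2 dvd_rfl) ?_
    · rw [untilt_tiltOfSequence]; exact hϖπ.symm.dvd
    · rw [← hv, ← mul_assoc, ← pow_succ', ← Nat.succ_eq_add_one, ← hq]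
  refine ⟨β, fun x => ?_⟩
  rw [hξ', hv, hvu.mul_right_dvd]

/-- An element killed by `ϖ` is killed by all `ϖ ^ (1 / p ^ n)`. -/
theorem root_mul_eq_zero_of_mul_eq_zero {π : S} (h : IsPerfectoidTopology p π)
    (hθ : Function.Surjective (fontaineTheta S p))
    (hker : (RingHom.ker (fontaineTheta S p)).IsPrincipal)
    {ϖ : ℕ → S} (hϖ : IsPowerRootSequence p ϖ) (hϖπ : Associated (ϖ 0) π)
    {s : S} (hs : ϖ 0 * s = 0) (n : ℕ) : ϖ n * s = 0 := by
  obtain ⟨β, hβ⟩ := exists_distinguished_generator h hθ hker hϖ hϖπ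
  have hred : IsReduced (WittVector p (PreTilt S p)) := isReduced_of_perfectRing
  have hredk : IsReduced (PreTilt S p) := PerfectRing.isReduced p _
  obtain ⟨x, rfl⟩ := hθ s
  obtain ⟨q, hq⟩ := Nat.exists_eq_add_of_le hp.out.two_le
  set a := tiltOfSequence hϖ 0 with ha
  set b := tiltOfSequence hϖ (n + 1) with hb
  have hba : b ^ p ^ (n + 1) = a := by
    have := tiltOfSequence_pow hϖ 0 (n + 1)
    rwa [zero_add] at this
  have hBA : teichmuller p b ^ p ^ (n + 1) = teichmuller p a := by rw [← map_pow, hba]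
  have hpos : p ^ (n + 1) ≠ 0 := pow_ne_zero _ hp.out.ne_zero
  obtain ⟨y, hy⟩ := (hβ (teichmuller p a * x)).1 (by
    rw [map_mul, ha, fontaineTheta_teichmuller_tiltOfSequence, hs])
  obtain ⟨z, hz⟩ : teichmuller p a ∣ p * y := by
    refine ⟨x + teichmuller p a ^ (q + 1) * β * y, ?_⟩
    rw [show teichmuller p a ^ p = teichmuller p a ^ 2 * teichmuller p a ^ q by
      rw [← pow_add, ← hq]] at hy
    linear_combination -hy
  -- Reducing `p * y = [a] * z` modulo `p` gives `a * z₀ = 0`. Since `a` is a power of `b` and the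
  -- tilt is reduced, already `b * z₀ = 0`.
  have hz0 : b * z.coeff 0 = 0 := by
    have h1 : a * z.coeff 0 = 0 := by
      have h2 := congrArg constantCoeff hz
      rw [map_mul, map_mul, map_natCast, CharP.cast_eq_zero, zero_mul] at h2
      have h3 : constantCoeff (teichmuller p a) = a := teichmuller_coeff_zero p a
      rw [h3] at h2
      exact h2.symm
    refine IsNilpotent.eq_zero ⟨p ^ (n + 1), ?_⟩
    obtain ⟨r, hr⟩ := Nat.exists_eq_succ_of_ne_zero hpos
    rw [mul_pow, hba, hr, pow_succ', ← mul_assoc, h1, zero_mul]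
  obtain ⟨w, hw⟩ := (p_dvd_iff (teichmuller p b * z)).2 (by
    rw [mul_coeff_zero, teichmuller_coeff_zero, hz0])
  have hyw : teichmuller p b * y = teichmuller p a * w := by
    apply eq_of_p_mul_eq
    linear_combination teichmuller p b * hz + teichmuller p a * hw
  -- With `[b] * y = [a] * w`, the error `u` of the relation `[b] * x = ξ * w`, where `ξ = p - [a] ^
  -- p * β`, is killed by `[a]`, hence by `[b]` as Witt vectors are reduced. So `θ` kills `[b] ^ 2 *
  -- x`, and `p ≥ 2` lets `ϖ n = ϖ (n + 1) ^ p` absorb the square.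
  set u := teichmuller p b * x - (p - teichmuller p a ^ p * β) * w with hu
  have hau : teichmuller p a * u = 0 := by
    rw [hu]
    linear_combination teichmuller p b * hy + (p - teichmuller p a ^ p * β) * hyw
  have hbu : teichmuller p b * u = 0 := by
    refine IsNilpotent.eq_zero ⟨p ^ (n + 1), ?_⟩
    obtain ⟨r, hr⟩ := Nat.exists_eq_succ_of_ne_zero hpos
    rw [mul_pow, hBA, hr, pow_succ', ← mul_assoc, hau, zero_mul]
  have h2 : fontaineTheta S p (teichmuller p b ^ 2 * x) = 0 := by
    refine (hβ _).2 ⟨teichmuller p b * w, ?_⟩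
    linear_combination hbu
  rw [map_mul, map_pow, hb, fontaineTheta_teichmuller_tiltOfSequence] at h2
  rw [← hϖ n, show ϖ (n + 1) ^ p = ϖ (n + 1) ^ 2 * ϖ (n + 1) ^ q by rw [← pow_add, ← hq]]
  linear_combination ϖ (n + 1) ^ q * h2

/-- The map `S / c → S / c ^ p`, `s ↦ s ^ p`, is injective for `c = ϖ ^ (1 / p ^ m)`. -/
theorem root_dvd_of_pow_dvd_pow {π : S} (h : IsPerfectoidTopology p π)
    (hθ : Function.Surjective (fontaineTheta S p))
    (hker : (RingHom.ker (fontaineTheta S p)).IsPrincipal)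
    {ϖ : ℕ → S} (hϖ : IsPowerRootSequence p ϖ) (hϖπ : Associated (ϖ 0) π)
    {s : S} {m : ℕ} (hs : ϖ m ^ p ∣ s ^ p) : ϖ m ∣ s := by
  obtain ⟨β, hβ⟩ := exists_distinguished_generator h hθ hker hϖ hϖπ
  have hredk : IsReduced (PreTilt S p) := PerfectRing.isReduced p _
  obtain ⟨x, rfl⟩ := hθ s
  obtain ⟨t, ht⟩ := hs
  obtain ⟨z, rfl⟩ := hθ t
  set a := tiltOfSequence hϖ 0 with ha
  set b := tiltOfSequence hϖ m with hb
  have hba : b ∣ a := by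
    have := tiltOfSequence_pow hϖ 0 m
    rw [zero_add] at this
    rw [ha, ← this]
    exact dvd_pow_self _ (pow_ne_zero _ hp.out.ne_zero)
  have hϖm : ϖ m ∣ (p : S) := by
    refine dvd_trans ?_ (hϖπ.dvd.trans h.dvd)
    have := hϖ.pow 0 m
    rw [zero_add] at this
    rw [← this]
    exact dvd_pow_self _ (pow_ne_zero _ hp.out.ne_zero)
  obtain ⟨y, hy⟩ := (hβ (x ^ p - teichmuller p b ^ p * z)).1 (by
    rw [map_sub, map_mul, map_pow, map_pow, hb, fontaineTheta_teichmuller_tiltOfSequence, ht,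
      sub_self])
  -- Modulo `p` the generator becomes `-a ^ p * β₀`, a multiple of `b ^ p`.
  have h0 : b ^ p ∣ x.coeff 0 ^ p := by
    have h1 := congrArg constantCoeff hy
    simp only [map_sub, map_mul, map_pow, map_natCast, CharP.cast_eq_zero, zero_sub] at h1
    change x.coeff 0 ^ p - (teichmuller p b).coeff 0 ^ p * _ =
      - ((teichmuller p a).coeff 0 ^ p * _) * _ at h1
    rw [teichmuller_coeff_zero, teichmuller_coeff_zero, sub_eq_iff_eq_add] at h1
    rw [h1]
    exact dvd_add (((pow_dvd_pow_of_dvd hba p).mul_right _).neg_right.mul_right _)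
      (dvd_mul_right _ _)
  -- Frobenius is bijective on the tilt, so the divisibility of `p`-th powers descends to the roots.
  obtain ⟨c, hc⟩ : b ∣ x.coeff 0 := by
    obtain ⟨d, hd⟩ := h0
    obtain ⟨c, rfl⟩ := (frobeniusEquiv (PreTilt S p) p).surjective d
    refine ⟨c, frobenius_inj (PreTilt S p) p ?_⟩
    rw [frobenius_def, frobenius_def, hd, mul_pow, _root_.frobeniusEquiv_apply, frobenius_def]
  obtain ⟨w, hw⟩ := (p_dvd_iff (x - teichmuller p b * teichmuller p c)).2 (by
    change constantCoeff (x - _) = 0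
    rw [← map_mul, ← hc, map_sub, sub_eq_zero]
    exact (teichmuller_coeff_zero p _).symm)
  rw [eq_add_of_sub_eq hw, map_add, map_mul, map_mul, map_natCast, hb,
    fontaineTheta_teichmuller_tiltOfSequence]
  exact dvd_add (hϖm.mul_right _) (dvd_mul_right _ _)

end Perfectoid

/-! ### Torsion and division of `p`-th powers in integral perfectoid rings. -/

namespace IsIntegralPerfectoid

variable {p : ℕ} [hp : Fact p.Prime] {S : Type*} [CommRing S] {π : S} {ϖ : ℕ → S}

/-- An element of an integral perfectoid ring killed by a power of `ϖ` is killed by all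
`ϖ ^ (1 / p ^ n)`. -/
theorem root_mul_eq_zero (h : IsIntegralPerfectoid p π) (hϖ : IsPowerRootSequence p ϖ)
    (hϖπ : Associated (ϖ 0) π) {s : S} {N : ℕ} (hs : ϖ 0 ^ N * s = 0) (n : ℕ) :
    ϖ n * s = 0 := by
  have : Fact (¬ IsUnit (p : S)) := ⟨h.not_isUnit⟩
  have := h.isAdicComplete_p
  have key := fun {s : S} => root_mul_eq_zero_of_mul_eq_zero h.toIsPerfectoidTopology
    (surjective_fontaineTheta h.frobenius_surjective) h.isPrincipal_ker hϖ hϖπ (s := s)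
  obtain ⟨q, hq⟩ := Nat.exists_eq_add_of_le hp.out.two_le
  have h1 : ∀ N, ϖ 0 ^ N * s = 0 → ϖ 0 * s = 0 := by
    intro N
    induction N with
    | zero => intro hs; rw [pow_zero, one_mul] at hs; rw [hs, mul_zero]
    | succ N ih =>
      intro hs
      rcases Nat.eq_zero_or_pos N with rfl | hN
      · simpa using hs
      · obtain ⟨M, rfl⟩ := Nat.exists_eq_add_of_le' hN
        refine ih ?_
        -- Each application of `key` trades a factor `ϖ 0` for `ϖ 1`. Two of them turn `ϖ 0 ^ 2`
        -- into `ϖ 1 ^ 2`, a divisor of `ϖ 0` because `p ≥ 2`, so the exponent drops by one.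
        have h2 : ϖ 1 * (ϖ 0 ^ (M + 1) * s) = 0 := key (by rw [← mul_assoc, ← pow_succ', hs]) 1
        have h3 : ϖ 1 * (ϖ 1 * (ϖ 0 ^ M * s)) = 0 := key (by linear_combination h2) 1
        have h4 : ϖ 0 = ϖ 1 ^ 2 * ϖ 1 ^ q := by rw [← pow_add, ← hq, hϖ 0]
        rw [pow_succ']
        nth_rewrite 1 [h4]
        linear_combination ϖ 1 ^ q * h3
  exact key (h1 N hs) n

theorem root_dvd (h : IsIntegralPerfectoid p π) (hϖ : IsPowerRootSequence p ϖ)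
    (hϖπ : Associated (ϖ 0) π) {s : S} {m : ℕ} (hs : ϖ m ^ p ∣ s ^ p) : ϖ m ∣ s := by
  have : Fact (¬ IsUnit (p : S)) := ⟨h.not_isUnit⟩
  have := h.isAdicComplete_p
  exact root_dvd_of_pow_dvd_pow h.toIsPerfectoidTopology
    (surjective_fontaineTheta h.frobenius_surjective) h.isPrincipal_ker hϖ hϖπ hs

end IsIntegralPerfectoid



end FontaineTheta

/-! ### Almost elements and power-bounded elements -/

section Almost

variable {p : ℕ} [hp : Fact p.Prime] {S : Type*} [CommRing S] {π : S} {ϖ : ℕ → S}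

local notation "ι" => algebraMap S (TateRing S (ϖ 0))

theorem TateRing.isUnit_algebraMap {R : Type*} [CommRing R] (t : R) :
    IsUnit (algebraMap R (TateRing R t) t) :=
  IsLocalization.Away.algebraMap_isUnit t

theorem TateRing.exists_pow_mul_eq_zero {R : Type*} [CommRing R] {t r : R}
    (hr : algebraMap R (TateRing R t) r = 0) : ∃ N : ℕ, t ^ N * r = 0 := by
  obtain ⟨⟨_, N, rfl⟩, hc⟩ :=
    (IsLocalization.map_eq_zero_iff (Submonoid.powers t) (TateRing R t) r).1 hr
  exact ⟨N, hc⟩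

theorem IsPowerRootSequence.pow_zero {p : ℕ} {S : Type*} [CommRing S] {ϖ : ℕ → S} (hϖ : IsPowerRootSequence p ϖ) (n : ℕ) :
    ϖ n ^ p ^ n = ϖ 0 := by
  simpa using hϖ.pow 0 n

theorem IsPowerRootSequence.isUnit_algebraMap (hϖ : IsPowerRootSequence p ϖ) (n : ℕ) :
    IsUnit (ι (ϖ n)) := by
  have h : IsUnit (ι (ϖ n ^ p ^ n)) := by
    rw [hϖ.pow_zero n]
    exact TateRing.isUnit_algebraMap (ϖ 0)
  rw [map_pow] at h
  exact (isUnit_pow_iff (pow_ne_zero _ hp.out.ne_zero)).1 h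

theorem mem_almostElements {hϖ : IsPowerRootSequence p ϖ} {x : TateRing S (ϖ 0)} :
    x ∈ almostElements p ϖ hϖ ↔ ∀ n : ℕ, 0 < n → ∃ s, ι s = ι (ϖ n) * x := Iff.rfl

theorem algebraMap_mem_almostElements (hϖ : IsPowerRootSequence p ϖ) (s : S) :
    ι s ∈ almostElements p ϖ hϖ := (toAlmostElements p ϖ hϖ s).2

theorem exists_eq_mul_of_mem_almostElements {hϖ : IsPowerRootSequence p ϖ}
    {x : TateRing S (ϖ 0)} (hx : x ∈ almostElements p ϖ hϖ) : ∃ s, ι s = ι (ϖ 0) * x := by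
  obtain ⟨s, hs⟩ := mem_almostElements.1 hx 1 one_pos
  obtain ⟨q, hq⟩ := Nat.exists_eq_succ_of_ne_zero hp.out.ne_zero
  refine ⟨ϖ 1 ^ q * s, ?_⟩
  rw [map_mul, hs, ← mul_assoc, ← map_mul, ← pow_succ, ← Nat.succ_eq_add_one, ← hq, hϖ 0]

theorem IsIntegralPerfectoid.root_mul_eq_zero_of_algebraMap (h : IsIntegralPerfectoid p π)
    (hϖ : IsPowerRootSequence p ϖ) (hϖπ : Associated (ϖ 0) π) {s : S} (hs : ι s = 0) (n : ℕ) :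
    ϖ n * s = 0 := by
  obtain ⟨N, hN⟩ := TateRing.exists_pow_mul_eq_zero hs
  exact h.root_mul_eq_zero hϖ hϖπ hN n

theorem exists_pow_mul_mem_range {p : ℕ} {S : Type*} [CommRing S] {ϖ : ℕ → S} (hϖ : IsPowerRootSequence p ϖ) (m : ℕ)
    (x : TateRing S (ϖ 0)) :
    ∃ (j : ℕ) (y : S), algebraMap S (TateRing S (ϖ 0)) y =
      algebraMap S (TateRing S (ϖ 0)) (ϖ m) ^ j * x := by
  obtain ⟨j, y, hy⟩ := TateRing.exists_pow_mul_eq x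
  refine ⟨p ^ m * j, y, ?_⟩
  rw [pow_mul, ← map_pow (algebraMap S (TateRing S (ϖ 0))), hϖ.pow_zero, ← hy, map_pow, mul_comm]

/-- The ring of almost elements of an integral perfectoid ring is closed under `p`-th roots. -/
theorem IsIntegralPerfectoid.mem_almostElements_of_pow (h : IsIntegralPerfectoid p π)
    (hϖ : IsPowerRootSequence p ϖ) (hϖπ : Associated (ϖ 0) π) {x : TateRing S (ϖ 0)}
    (hx : x ^ p ∈ almostElements p ϖ hϖ) : x ∈ almostElements p ϖ hϖ := by
  rw [mem_almostElements]
  intro m hm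
  obtain ⟨s, hs⟩ := mem_almostElements.1 hx m hm
  have he : ι (ϖ (m + 1)) ^ p = ι (ϖ m) := by rw [← map_pow, hϖ]
  -- Write `c = ϖ (m + 1)`, so `c ^ p = ϖ m`. If `y` lifts `c ^ j * x`, then `y ^ p` is `ϖ m ^ (j -
  -- 1) * s` up to torsion, which `ϖ m` kills. Hence `(c * y) ^ p = ϖ m ^ j * s` is divisible by `ϖ
  -- m ^ p`, so `ϖ m` divides `c * y`, and the quotient lifts `c ^ (j + 1 - p) * x`.
  have hstep : ∀ j, p ≤ j → (∃ y, ι y = ι (ϖ (m + 1)) ^ j * x) →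
      ∃ y, ι y = ι (ϖ (m + 1)) ^ (j + 1 - p) * x := by
    rintro j hj ⟨y, hy⟩
    obtain ⟨i, rfl⟩ := Nat.exists_eq_add_of_le hj
    obtain ⟨q, hq⟩ := Nat.exists_eq_succ_of_ne_zero hp.out.ne_zero
    have h0 : ι (y ^ p - ϖ m ^ (q + i) * s) = 0 := by
      rw [map_sub, map_mul, map_pow, map_pow, hs, hy, sub_eq_zero, mul_pow, ← pow_mul, mul_comm _ p,
        pow_mul, he, ← mul_assoc, ← pow_succ, hq]
      congr 2
      omega
    have h1 := h.root_mul_eq_zero_of_algebraMap hϖ hϖπ h0 m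
    obtain ⟨t, ht⟩ : ϖ m ∣ ϖ (m + 1) * y := by
      refine h.root_dvd hϖ hϖπ ⟨ϖ m ^ i * s, ?_⟩
      rw [mul_pow, hϖ, ← mul_assoc, ← pow_add, show p + i = q + i + 1 by omega, pow_succ']
      linear_combination h1
    refine ⟨t, (hϖ.isUnit_algebraMap m).mul_left_cancel ?_⟩
    rw [← map_mul, ← ht, map_mul, hy, ← he, ← mul_assoc, ← mul_assoc, ← pow_succ', ← pow_add]
    congr 2
    omega
  have hdesc : ∀ j, (∃ y, ι y = ι (ϖ (m + 1)) ^ j * x) → ∃ y, ι y = ι (ϖ (m + 1)) ^ p * x := by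
    intro j
    induction j using Nat.strong_induction_on with
    | _ j ih =>
      intro hy
      rcases le_or_gt p j with hj | hj
      · exact ih _ (by have := hp.out.two_le; omega) (hstep j hj hy)
      · obtain ⟨y, hy⟩ := hy
        refine ⟨ϖ (m + 1) ^ (p - j) * y, ?_⟩
        rw [map_mul, hy, map_pow, ← mul_assoc, ← pow_add, Nat.sub_add_cancel hj.le]
  rw [← he]
  obtain ⟨j, hj⟩ := exists_pow_mul_mem_range hϖ (m + 1) x
  exact hdesc j hj

theorem IsIntegralPerfectoid.mem_almostElements_of_pow_pow (h : IsIntegralPerfectoid p π)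
    (hϖ : IsPowerRootSequence p ϖ) (hϖπ : Associated (ϖ 0) π) {x : TateRing S (ϖ 0)} {n : ℕ}
    (hx : x ^ p ^ n ∈ almostElements p ϖ hϖ) : x ∈ almostElements p ϖ hϖ := by
  induction n with
  | zero => simpa using hx
  | succ n ih => exact ih (h.mem_almostElements_of_pow hϖ hϖπ (by rwa [← pow_mul, ← pow_succ]))

/-- Power-bounded elements of `S[1/ϖ]` lie in `S_*`. -/
theorem IsIntegralPerfectoid.mem_almostElements_of_bounded (h : IsIntegralPerfectoid p π)
    (hϖ : IsPowerRootSequence p ϖ) (hϖπ : Associated (ϖ 0) π) {x : TateRing S (ϖ 0)} {N : ℕ}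
    (hx : ∀ k : ℕ, ∃ s, ι s = ι (ϖ 0) ^ N * x ^ k) : x ∈ almostElements p ϖ hϖ := by
  rw [mem_almostElements]
  intro m _
  have hz : ι (ϖ (m + 1)) * x ∈ almostElements p ϖ hϖ := by
    -- The exponent `p ^ (m + 1 + N)` turns `ϖ (m + 1)` into `ϖ 0 ^ p ^ N`, and `p ^ N ≥ N` clears
    -- the common denominator.
    refine h.mem_almostElements_of_pow_pow hϖ hϖπ (n := (m + 1) + N) ?_
    obtain ⟨s, hs⟩ := hx (p ^ ((m + 1) + N))
    obtain ⟨d, hd⟩ := Nat.exists_eq_add_of_le (Nat.lt_pow_self (n := N) hp.out.one_lt).le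
    have : (ι (ϖ (m + 1)) * x) ^ p ^ (m + 1 + N) = ι (ϖ 0 ^ d * s) := by
      rw [mul_pow, map_mul, hs, map_pow, ← mul_assoc, ← pow_add, add_comm d, ← hd, pow_add p,
        pow_mul (ι _), ← map_pow, hϖ.pow_zero]
    rw [this]
    exact algebraMap_mem_almostElements hϖ _
  obtain ⟨s, hs⟩ := mem_almostElements.1 hz (m + 1) m.succ_pos
  obtain ⟨q, hq⟩ := Nat.exists_eq_add_of_le hp.out.two_le
  refine ⟨ϖ (m + 1) ^ q * s, ?_⟩
  have he : ι (ϖ m) = ι (ϖ (m + 1)) ^ 2 * ι (ϖ (m + 1)) ^ q := by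
    rw [← pow_add, ← hq, ← map_pow, hϖ]
  rw [map_mul, hs, map_pow, he]
  ring

/-! ### Completeness of the ring of almost elements -/

theorem IsIntegralPerfectoid.eq_zero_of_dvd (h : IsIntegralPerfectoid p π)
    (hϖπ : Associated (ϖ 0) π) {s : S} (hs : ∀ n, ϖ 0 ^ n ∣ s) : s = 0 :=
  h.isAdicComplete.haus' s fun n => (IsPerfectoidTopology.smodEq_iff π n s 0).2
    (by simpa using (pow_dvd_pow_of_dvd hϖπ.symm.dvd n).trans (hs n))

/-- An element divisible by all powers of `ϖ` in the ring of almost elements is zero. -/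
theorem IsIntegralPerfectoid.eq_zero_of_forall_mem (h : IsIntegralPerfectoid p π)
    (hϖ : IsPowerRootSequence p ϖ) (hϖπ : Associated (ϖ 0) π) {x : TateRing S (ϖ 0)}
    (hx : ∀ n : ℕ, ∃ y ∈ almostElements p ϖ hϖ, x = ι (ϖ 0) ^ n * y) : x = 0 := by
  have hu := TateRing.isUnit_algebraMap (ϖ 0)
  obtain ⟨y, hy, hxy⟩ := hx 0
  rw [_root_.pow_zero, one_mul] at hxy
  obtain ⟨s, hs⟩ := exists_eq_mul_of_mem_almostElements (hxy ▸ hy)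
  -- `s` itself is divisible by `ϖ 0 ^ n` only up to torsion; the factor `ϖ 0` kills that torsion.
  have h0 : ϖ 0 * s = 0 := by
    refine h.eq_zero_of_dvd hϖπ fun n => ?_
    obtain ⟨z, hz, hxz⟩ := hx n
    obtain ⟨t, ht⟩ := exists_eq_mul_of_mem_almostElements hz
    have h1 : ι (s - ϖ 0 ^ n * t) = 0 := by
      rw [map_sub, map_mul, map_pow, hs, ht, hxz]; ring
    have h2 := h.root_mul_eq_zero_of_algebraMap hϖ hϖπ h1 0
    exact ⟨ϖ 0 * t, by linear_combination h2⟩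
  have h1 := congrArg (ι) h0
  rw [map_mul, hs, map_zero, hu.mul_right_eq_zero, hu.mul_right_eq_zero] at h1
  exact h1

/-- Tails of `ϖ`-adic power series. -/
theorem IsIntegralPerfectoid.exists_tails (h : IsIntegralPerfectoid p π)
    (hϖπ : Associated (ϖ 0) π) (e : ℕ → S) : ∃ r : ℕ → S, ∀ n, r n = e n + ϖ 0 * r (n + 1) := by
  have hd : ∀ n, π ^ n ∣ ϖ 0 ^ n := fun n => pow_dvd_pow_of_dvd hϖπ.symm.dvd n
  have hd' : ∀ n, ϖ 0 ^ n ∣ π ^ n := fun n => pow_dvd_pow_of_dvd hϖπ.dvd n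
  -- The tail `r n` is the limit of these partial sums of `∑ ϖ 0 ^ i * e (n + i)`.
  let s : ℕ → ℕ → S := fun n m => ∑ i ∈ Finset.range m, ϖ 0 ^ i * e (n + i)
  have hl : ∀ n, ∃ l, ∀ m, ϖ 0 ^ m ∣ s n m - l := by
    intro n
    obtain ⟨l, hl⟩ := h.isAdicComplete.prec' (f := s n) (by
      intro a b hab
      rw [IsPerfectoidTopology.smodEq_iff, dvd_sub_comm]
      change _ ∣ (∑ k ∈ Finset.range b, _) - ∑ k ∈ Finset.range a, _
      rw [← Finset.sum_range_add_sum_Ico _ hab, add_sub_cancel_left]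
      refine Finset.dvd_sum fun k hk => ?_
      exact ((pow_dvd_pow π (Finset.mem_Ico.1 hk).1).trans (hd k)).mul_right _)
    exact ⟨l, fun m => (hd' m).trans ((IsPerfectoidTopology.smodEq_iff _ _ _ _).1 (hl m))⟩
  choose r hr using hl
  refine ⟨r, fun n => ?_⟩
  rw [← sub_eq_zero]
  refine h.eq_zero_of_dvd hϖπ fun m => ?_
  have h1 : s n (m + 1) = e n + ϖ 0 * s (n + 1) m := by
    change ∑ i ∈ Finset.range (m + 1), _ = _
    rw [Finset.sum_range_succ', Finset.mul_sum, add_comm]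
    congr 1
    · simp
    · refine Finset.sum_congr rfl fun i _ => ?_
      rw [pow_succ', mul_assoc, add_right_comm, add_assoc n]
  have h2 := (pow_dvd_pow (ϖ 0) m.le_succ).trans (hr n (m + 1))
  have h3 := (hr (n + 1) m).mul_left (ϖ 0)
  rw [h1] at h2
  convert dvd_sub h3 h2 using 1
  ring

/-- The ring of almost elements is `ϖ`-adically complete. -/
theorem IsIntegralPerfectoid.isAdicComplete_almostElements (h : IsIntegralPerfectoid p π)
    (hϖ : IsPowerRootSequence p ϖ) (hϖπ : Associated (ϖ 0) π) :
    IsAdicComplete (Ideal.span {toAlmostElements p ϖ hϖ (ϖ 0)}) (almostElements p ϖ hϖ) where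
  haus' x hx := by
    apply Subtype.ext
    refine h.eq_zero_of_forall_mem hϖ hϖπ fun n => ?_
    obtain ⟨y, hy⟩ := (IsPerfectoidTopology.smodEq_iff _ n x 0).1 (hx n)
    rw [sub_zero] at hy
    exact ⟨y, y.2, congrArg Subtype.val hy⟩
  prec' f hf := by
    have hf' : ∀ n, ∃ d, f (n + 1) - f n = toAlmostElements p ϖ hϖ (ϖ 0) ^ n * d := fun n => by
      have := (IsPerfectoidTopology.smodEq_iff _ n _ _).1 (hf (Nat.le_succ n))
      rw [dvd_sub_comm] at this
      exact this
    choose d hd using hf'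
    -- The increments `d n` need not come from `S`, but `ϖ 0 * d n` does. Hence `∑ ϖ 0 ^ n * d n`
    -- over `n ≥ 1` equals `∑ ϖ 0 ^ (n - 1) * e n`, whose sum `r 1` exists in `S`; the limit is `f 1
    -- + r 1`.
    choose e he using fun n => exists_eq_mul_of_mem_almostElements (d n).2
    have he' : ∀ n, toAlmostElements p ϖ hϖ (e n) = toAlmostElements p ϖ hϖ (ϖ 0) * d n :=
      fun n => Subtype.ext (he n)
    obtain ⟨r, hr⟩ := h.exists_tails hϖπ e
    have key : ∀ n, f 1 + toAlmostElements p ϖ hϖ (r 1) =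
        f (n + 1) + toAlmostElements p ϖ hϖ (ϖ 0) ^ n * toAlmostElements p ϖ hϖ (r (n + 1)) := by
      intro n
      induction n with
      | zero => simp
      | succ n ih =>
        rw [ih, hr (n + 1), map_add, map_mul, he']
        linear_combination -hd (n + 1)
    refine ⟨f 1 + toAlmostElements p ϖ hϖ (r 1), fun n => ?_⟩
    rw [IsPerfectoidTopology.smodEq_iff, dvd_sub_comm]
    refine ⟨d n + toAlmostElements p ϖ hϖ (r (n + 1)), ?_⟩
    rw [key n]
    linear_combination hd n

end Almost

/-- A ring homomorphism to a `J`-adically complete ring mapping a power of `I` to `J` extends to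
the `I`-adic completion. -/
theorem AdicCompletion.exists_extend {R T : Type*} [CommRing R] [CommRing T] (I : Ideal R)
    (J : Ideal T) [IsAdicComplete J T] (h : R →+* T) {r : ℕ} (hr : (I ^ r).map h ≤ J) :
    ∃ F : AdicCompletion I R →+* T, ∀ a, F (algebraMap R _ a) = h a := by
  have hle : ∀ n, I ^ (r * n) ≤ (J ^ n).comap h := fun n => by
    rw [← Ideal.map_le_iff_le_comap, pow_mul, Ideal.map_pow]
    exact Ideal.pow_right_mono hr n
  let f : ∀ n, AdicCompletion I R →+* T ⧸ J ^ n := fun n =>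
    (Ideal.quotientMap (J ^ n) h (hle n)).comp (AdicCompletion.evalₐ I (r * n)).toRingHom
  have hf : ∀ {m n : ℕ} (hmn : m ≤ n),
      (Ideal.Quotient.factorPow J hmn).comp (f n) = f m := by
    intro m n hmn
    ext x
    obtain ⟨x, rfl⟩ := AdicCompletion.mk_surjective I R x
    change Ideal.Quotient.factorPow J hmn (Ideal.quotientMap (J ^ n) h (hle n)
      (evalₐ I (r * n) (mk I R x))) =
      Ideal.quotientMap (J ^ m) h (hle m) (evalₐ I (r * m) (mk I R x))
    rw [evalₐ_mk, evalₐ_mk, Ideal.quotientMap_mk, Ideal.quotientMap_mk]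
    change Ideal.Quotient.mk (J ^ m) (h (x.val (r * n))) = _
    rw [Ideal.Quotient.eq, ← map_sub]
    refine hle m ?_
    rw [← Ideal.Quotient.eq]
    exact (Ideal.mk_eq_mk I (Nat.mul_le_mul_left r hmn) x)
  refine ⟨IsAdicComplete.liftRingHom J f hf, fun a => ?_⟩
  rw [IsHausdorff.eq_iff_smodEq (I := J)]
  intro n
  rw [SModEq.sub_mem, smul_eq_mul, Ideal.mul_top, ← Ideal.Quotient.eq,
    IsAdicComplete.mk_liftRingHom]
  change Ideal.quotientMap (J ^ n) h (hle n) (evalₐ I (r * n) (algebraMap R _ a)) = _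
  rw [AlgHom.commutes]
  rfl

/-! ### The map out of the uniform completion -/

/-- Power-boundedness, tested against the image of `R`, gives one denominator `t ^ n` valid for all
powers of `x`. -/
theorem TateRing.exists_pow_mul_mem {R : Type*} [CommRing R] {t : R} {x : TateRing R t}
    (hx : IsPowerBounded x) : ∃ n : ℕ, ∀ k : ℕ, ∃ s : R,
      algebraMap R (TateRing R t) s = algebraMap R (TateRing R t) t ^ n * x ^ k := by
  obtain ⟨V, hV, hVx⟩ := hx _ ((hasBasis_nhds_zero R t).mem_of_mem (i := 0) trivial)
  obtain ⟨n, -, hn⟩ := (hasBasis_nhds_zero R t).mem_iff.1 hV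
  refine ⟨n, fun k => ?_⟩
  obtain ⟨s, hs⟩ := mem_ball.1 (hVx _ (hn (mem_ball.2 ⟨1, rfl⟩)) _ ⟨k, rfl⟩)
  refine ⟨s, ?_⟩
  rw [_root_.pow_zero, mul_one] at hs
  rw [hs, one_mul, map_pow]

/-- The canonical map `A₀[1/π] → S[1/ϖ]`. -/
def tateMap {A₀ : Type*} [CommRing A₀] {π : A₀} {S : Type*} [CommRing S] [Algebra A₀ S] {ϖ : S}
    (hϖπ : Associated ϖ (algebraMap A₀ S π)) : TateRing A₀ π →+* TateRing S ϖ :=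
  IsLocalization.Away.lift (S := TateRing A₀ π) π
    (g := (algebraMap S (TateRing S ϖ)).comp (algebraMap A₀ S)) (by
      obtain ⟨u, hu⟩ := hϖπ
      rw [RingHom.comp_apply, ← hu, map_mul]
      exact (TateRing.isUnit_algebraMap ϖ).mul (u.isUnit.map _))

/-! ### Existence, continuity and uniqueness of the extension. -/

section Main

variable {p : ℕ} [hp : Fact p.Prime] {A₀ : Type*} [CommRing A₀] {π : A₀}
  {S : Type*} [CommRing S] [Algebra A₀ S] {ϖ : ℕ → S}

theorem tateMap_algebraMap {ϖ : S} (hϖπ : Associated ϖ (algebraMap A₀ S π)) (a : A₀) :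
    tateMap hϖπ (algebraMap A₀ (TateRing A₀ π) a) =
      algebraMap S (TateRing S ϖ) (algebraMap A₀ S a) :=
  IsLocalization.Away.lift_eq (S := TateRing A₀ π) π _ a

/-- A common denominator `π ^ n` of the powers of `x` becomes a common denominator `ϖ ^ n` of the
powers of its image. -/
theorem IsIntegralPerfectoid.tateMap_mem (hS : IsIntegralPerfectoid p (algebraMap A₀ S π))
    (hϖ : IsPowerRootSequence p ϖ) (hϖπ : Associated (ϖ 0) (algebraMap A₀ S π))
    {x : TateRing A₀ π} (hx : IsPowerBounded x) :
    tateMap hϖπ x ∈ almostElements p ϖ hϖ := by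
  obtain ⟨n, hn⟩ := TateRing.exists_pow_mul_mem hx
  obtain ⟨c, hc⟩ := hϖπ.symm.dvd
  refine hS.mem_almostElements_of_bounded hϖ hϖπ (N := n) fun k => ?_
  obtain ⟨s, hs⟩ := hn k
  refine ⟨c ^ n * algebraMap A₀ S s, ?_⟩
  have h := congrArg (tateMap hϖπ) hs
  rw [tateMap_algebraMap, map_mul, map_pow, map_pow, tateMap_algebraMap] at h
  have hc' : algebraMap S (TateRing S (ϖ 0)) (ϖ 0) =
      algebraMap S _ (algebraMap A₀ S π) * algebraMap S _ c := by rw [← map_mul, ← hc]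
  rw [map_mul, h, map_pow, hc']
  ring

variable (D : UniformizationData (TateRing A₀ π))

/-- The canonical map from a ring of integral elements of `A₀[1/π]` to `S_*`. -/
def plusToAlmostElements (hS : IsIntegralPerfectoid p (algebraMap A₀ S π))
    (hϖ : IsPowerRootSequence p ϖ) (hϖπ : Associated (ϖ 0) (algebraMap A₀ S π)) :
    D.Aplus →+* almostElements p ϖ hϖ :=
  ((tateMap hϖπ).comp D.Aplus.subtype).codRestrict (almostElements p ϖ hϖ) fun a =>
    hS.tateMap_mem hϖ hϖπ (D.isRingOfIntegralElements.isPowerBounded _ a.2)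

theorem UniformizationData.isUnit_tPlus : IsUnit (D.tPlus : TateRing A₀ π) :=
  haveI := D.isLocalization_plus
  IsLocalization.Away.algebraMap_isUnit (S := TateRing A₀ π) D.tPlus

/-- Some power of the topologically nilpotent unit of `A₀[1/π]` becomes divisible by `ϖ` in
`S_*`. -/
theorem exists_plusToAlmostElements_pow_eq (hS : IsIntegralPerfectoid p (algebraMap A₀ S π))
    (hϖ : IsPowerRootSequence p ϖ) (hϖπ : Associated (ϖ 0) (algebraMap A₀ S π)) :
    ∃ r : ℕ, toAlmostElements p ϖ hϖ (ϖ 0) ∣ plusToAlmostElements D hS hϖ hϖπ D.tPlus ^ r := by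
  -- `t` is related to `π` only through the topology: it is topologically nilpotent, so some power
  -- lies in `π` times the image of `A₀`.
  obtain ⟨r, hr⟩ := D.exists_pow_mem
    ((TateRing.hasBasis_nhds_zero A₀ π).mem_of_mem (i := 1) trivial)
  obtain ⟨a, ha⟩ := TateRing.mem_ball.1 hr
  obtain ⟨c, hc⟩ := hϖπ.dvd
  refine ⟨r, toAlmostElements p ϖ hϖ (c * algebraMap A₀ S a), Subtype.ext ?_⟩
  change tateMap hϖπ (D.tPlus : TateRing A₀ π) ^ r =
    algebraMap S (TateRing S (ϖ 0)) (ϖ 0) * algebraMap S (TateRing S (ϖ 0)) _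
  rw [← map_pow, ← ha, tateMap_algebraMap, pow_one, map_mul, hc, ← map_mul]
  congr 1
  ring

/-- The extension of `A₀[1/π] → S[1/ϖ]` to the uniform completion. -/
theorem exists_uniformCompletion_extension (hS : IsIntegralPerfectoid p (algebraMap A₀ S π))
    (hϖ : IsPowerRootSequence p ϖ) (hϖπ : Associated (ϖ 0) (algebraMap A₀ S π)) :
    ∃ F : D.UniformCompletion →+* TateRing S (ϖ 0),
      (∀ a, F (D.toUniformCompletion a) = tateMap hϖπ a) ∧
      ∀ r : D.Completion, F (algebraMap _ _ r) ∈ almostElements p ϖ hϖ := by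
  have := hS.isAdicComplete_almostElements hϖ hϖπ
  obtain ⟨r, hr⟩ := exists_plusToAlmostElements_pow_eq D hS hϖ hϖπ
  obtain ⟨F₀, hF₀⟩ := AdicCompletion.exists_extend (Ideal.span {D.tPlus})
    (Ideal.span {toAlmostElements p ϖ hϖ (ϖ 0)}) (plusToAlmostElements D hS hϖ hϖπ) (r := r) (by
      rw [Ideal.span_singleton_pow, Ideal.map_span, Set.image_singleton, map_pow,
        Ideal.span_singleton_le_iff_mem, Ideal.mem_span_singleton]
      exact hr)
  have hunit : IsUnit (((almostElements p ϖ hϖ).subtype.comp F₀)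
      (algebraMap D.Aplus D.Completion D.tPlus)) := by
    rw [RingHom.comp_apply, hF₀]
    exact D.isUnit_tPlus.map (tateMap hϖπ)
  let F : D.UniformCompletion →+* TateRing S (ϖ 0) :=
    IsLocalization.Away.lift (S := D.UniformCompletion)
      (algebraMap D.Aplus D.Completion D.tPlus) hunit
  have hF : ∀ r, F (algebraMap _ _ r) = F₀ r := fun r =>
    IsLocalization.Away.lift_eq (S := D.UniformCompletion) _ hunit r
  refine ⟨F, fun a => ?_, fun r => by rw [hF]; exact (F₀ r).2⟩
  have := D.isLocalization_plus
  have he : F.comp D.toUniformCompletion = tateMap hϖπ := by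
    refine IsLocalization.ringHom_ext (Submonoid.powers D.tPlus) (RingHom.ext fun a => ?_)
    exact (congrArg F (D.toUniformCompletion_coe a)).trans
      ((hF (algebraMap D.Aplus D.Completion a)).trans (congrArg Subtype.val (hF₀ a)))
  exact DFunLike.congr_fun he a

theorem toUniformCompletion_tPlus : D.toUniformCompletion (D.tPlus : TateRing A₀ π) =
    algebraMap D.Completion D.UniformCompletion (algebraMap D.Aplus D.Completion D.tPlus) :=
  D.toUniformCompletion_coe D.tPlus

theorem continuous_of_forall_mem (hS : IsIntegralPerfectoid p (algebraMap A₀ S π))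
    (hϖ : IsPowerRootSequence p ϖ) (hϖπ : Associated (ϖ 0) (algebraMap A₀ S π))
    (F : D.UniformCompletion →+* TateRing S (ϖ 0))
    (hF : ∀ a, F (D.toUniformCompletion a) = tateMap hϖπ a)
    (hF' : ∀ r : D.Completion, F (algebraMap _ _ r) ∈ almostElements p ϖ hϖ) : Continuous F := by
  obtain ⟨r, z, hz⟩ := exists_plusToAlmostElements_pow_eq D hS hϖ hϖπ
  have hz' : tateMap hϖπ (D.tPlus : TateRing A₀ π) ^ r =
    algebraMap S (TateRing S (ϖ 0)) (ϖ 0) * z := congrArg Subtype.val hz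
  refine continuous_of_continuousAt_zero F ?_
  rw [ContinuousAt, map_zero,
    (TateRing.hasBasis_nhds_zero _ _).tendsto_iff (TateRing.hasBasis_nhds_zero _ _)]
  intro n _
  -- `t ^ (r * (n + 1))` maps into `ϖ ^ (n + 1) * S_*`; the extra factor `ϖ` is spent on moving
  -- `S_*` into the image of `S`.
  refine ⟨r * (n + 1), trivial, fun x hx => ?_⟩
  obtain ⟨y, rfl⟩ := TateRing.mem_ball.1 hx
  obtain ⟨s, hs⟩ := exists_eq_mul_of_mem_almostElements
    ((almostElements p ϖ hϖ).mul_mem (hF' y) (pow_mem z.2 (n + 1)))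
  refine TateRing.mem_ball.2 ⟨s, ?_⟩
  rw [map_mul, hs, map_mul, map_mul, map_pow, map_pow, map_pow, ← toUniformCompletion_tPlus, hF,
    pow_mul, hz']
  ring

theorem IsIntegralPerfectoid.extension_mem (hS : IsIntegralPerfectoid p (algebraMap A₀ S π))
    (hϖ : IsPowerRootSequence p ϖ) (hϖπ : Associated (ϖ 0) (algebraMap A₀ S π))
    (F : D.UniformCompletion →+* TateRing S (ϖ 0))
    (hF : ∀ a, F (D.toUniformCompletion a) = tateMap hϖπ a)
    (hF' : ∀ r : D.Completion, F (algebraMap _ _ r) ∈ almostElements p ϖ hϖ)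
    {x : D.UniformCompletion} (hx : IsPowerBounded x) : F x ∈ almostElements p ϖ hϖ := by
  obtain ⟨n, hn⟩ := TateRing.exists_pow_mul_mem hx
  obtain ⟨b, hb⟩ := ((D.isUnit_tPlus.map (tateMap hϖπ)).pow n).exists_right_inv
  obtain ⟨j, c, hc⟩ := exists_pow_mul_mem_range hϖ 0 b
  -- `ϖ ^ j` clears the denominator of the inverse `b` of the image of `t ^ n`, and one more `ϖ`
  -- carries `F s` from `S_*` into the image of `S`.
  refine hS.mem_almostElements_of_bounded hϖ hϖπ (N := j + 1) fun k => ?_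
  obtain ⟨s, hs⟩ := hn k
  obtain ⟨u, hu⟩ := exists_eq_mul_of_mem_almostElements (hF' s)
  refine ⟨c * u, ?_⟩
  rw [map_mul, hu, hc, hs, map_mul, map_pow, map_pow, ← toUniformCompletion_tPlus, hF]
  linear_combination algebraMap S (TateRing S (ϖ 0)) (ϖ 0) ^ (j + 1) * F x ^ k * hb

/-- The elements of the completion of `Aplus` are approximated by elements of `Aplus`. -/
theorem UniformizationData.exists_sub_eq (r : D.Completion) (n : ℕ) :
    ∃ (a : D.Aplus) (s : D.Completion), r - algebraMap D.Aplus D.Completion a =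
      s * algebraMap D.Aplus D.Completion D.tPlus ^ n := by
  obtain ⟨a, ha⟩ := Submodule.mkQ_surjective _ (r.val n)
  have h : r - algebraMap D.Aplus D.Completion a ∈
      LinearMap.ker (AdicCompletion.eval (Ideal.span {D.tPlus}) D.Aplus n) := by
    rw [LinearMap.mem_ker, map_sub, sub_eq_zero]
    exact ha.symm
  -- Since the ideal is finitely generated, the kernel of reduction modulo `t ^ n` is `t ^ n` times
  -- the completion.
  rw [← AdicCompletion.pow_smul_top_eq_ker_eval (Submodule.fg_span_singleton _),
    Ideal.span_singleton_pow, Submodule.ideal_span_singleton_smul] at h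
  obtain ⟨s, -, hs⟩ := (Submodule.mem_smul_pointwise_iff_exists _ _ _).1 h
  refine ⟨a, s, hs.symm.trans ?_⟩
  rw [Algebra.smul_def, map_pow, mul_comm]

set_option maxHeartbeats 800000 in
-- The values on `A⁺` are forced algebraically because `π` is invertible in `S[1/ϖ]`, those on its
-- completion by continuity and separatedness, and the rest because `t` is invertible.
theorem IsIntegralPerfectoid.eq_of_continuous (hS : IsIntegralPerfectoid p (algebraMap A₀ S π))
    (hϖ : IsPowerRootSequence p ϖ) (hϖπ : Associated (ϖ 0) (algebraMap A₀ S π))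
    {f g : powerBoundedSubring D.UniformCompletion →+* almostElements p ϖ hϖ}
    (hf : Continuous f) (hg : Continuous g)
    (hf' : ∀ a : A₀, f (toPowerBoundedUniformCompletion D a) =
      toAlmostElements p ϖ hϖ (algebraMap A₀ S a))
    (hg' : ∀ a : A₀, g (toPowerBoundedUniformCompletion D a) =
      toAlmostElements p ϖ hϖ (algebraMap A₀ S a)) : f = g := by
  let c : D.Aplus → powerBoundedSubring D.UniformCompletion := fun a =>
    ⟨D.toUniformCompletion a, D.isPowerBounded_toUniformCompletion
      (D.isRingOfIntegralElements.isPowerBounded _ a.2)⟩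
  let d : D.Completion → powerBoundedSubring D.UniformCompletion := fun r =>
    ⟨algebraMap _ _ r, TateRing.isPowerBounded_algebraMap r⟩
  have hc : ∀ f : powerBoundedSubring D.UniformCompletion →+* almostElements p ϖ hϖ,
      (∀ a : A₀, f (toPowerBoundedUniformCompletion D a) =
        toAlmostElements p ϖ hϖ (algebraMap A₀ S a)) →
      ∀ a : D.Aplus, (f (c a) : TateRing S (ϖ 0)) = tateMap hϖπ (a : TateRing A₀ π) := by
    intro f hf a
    obtain ⟨n, s, hs⟩ := TateRing.exists_pow_mul_eq (a : TateRing A₀ π)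
    have h1 : c a * toPowerBoundedUniformCompletion D (π ^ n) =
        toPowerBoundedUniformCompletion D s :=
      Subtype.ext ((map_mul D.toUniformCompletion _ _).symm.trans (congrArg _ hs))
    have h2 := congrArg (fun x => (f x : TateRing S (ϖ 0))) h1
    simp only [map_mul, hf] at h2
    have h3 := congrArg (tateMap hϖπ) hs
    rw [map_mul, tateMap_algebraMap, tateMap_algebraMap] at h3
    refine (?_ : IsUnit (algebraMap S (TateRing S (ϖ 0)) (algebraMap A₀ S (π ^ n)))).mul_right_cancel
      (h2.trans h3.symm)
    rw [← tateMap_algebraMap hϖπ, map_pow]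
    exact ((TateRing.isUnit_algebraMap π).pow n).map _
  -- `f - g` vanishes on `A⁺`, and `r` differs from some element of `A⁺` by an arbitrarily high
  -- multiple of `t`. Continuity then puts `f (d r) - g (d r)` in every `ϖ ^ n * S_*`.
  have hd : ∀ r, f (d r) = g (d r) := by
    intro r
    rw [← sub_eq_zero]
    apply Subtype.ext
    refine hS.eq_zero_of_forall_mem hϖ hϖπ fun n => ?_
    have hcont : Continuous fun x => ((f x - g x : almostElements p ϖ hϖ) : TateRing S (ϖ 0)) :=
      continuous_subtype_val.comp (hf.sub hg)
    have hnhds := hcont.continuousAt (x := 0)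
      (show (TateRing.ball S (ϖ 0) n : Set _) ∈ 𝓝 _ by
        simpa using (TateRing.hasBasis_nhds_zero S (ϖ 0)).mem_of_mem (i := n) trivial)
    rw [Filter.mem_map, nhds_subtype_eq_comap, Filter.mem_comap] at hnhds
    obtain ⟨W, hW, hWn⟩ := hnhds
    obtain ⟨m, -, hm⟩ := (TateRing.hasBasis_nhds_zero _ _).mem_iff.1 hW
    obtain ⟨a, s, has⟩ := D.exists_sub_eq r m
    have hmem : d (r - algebraMap D.Aplus D.Completion a) ∈
        (fun x => ((f x - g x : almostElements p ϖ hϖ) : TateRing S (ϖ 0))) ⁻¹'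
          (TateRing.ball S (ϖ 0) n : Set _) := by
      refine hWn (hm (TateRing.mem_ball.2 ⟨s, ?_⟩))
      rw [has]
    have hda : d r = d (r - algebraMap D.Aplus D.Completion a) + c a := by
      apply Subtype.ext
      change algebraMap _ _ r = algebraMap _ _ _ + D.toUniformCompletion a
      rw [D.toUniformCompletion_coe, map_sub]
      exact (sub_add_cancel _ _).symm
    have hca : f (c a) = g (c a) := Subtype.ext ((hc f hf' a).trans (hc g hg' a).symm)
    obtain ⟨y, hy⟩ := TateRing.mem_ball.1 hmem
    refine ⟨_, algebraMap_mem_almostElements hϖ y, ?_⟩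
    rw [hda, map_add, map_add, hca, add_sub_add_right_eq_sub, ← map_pow, ← map_mul, mul_comm, hy]
  refine RingHom.ext fun x => Subtype.ext ?_
  obtain ⟨n, r, hr⟩ := TateRing.exists_pow_mul_eq (x : D.UniformCompletion)
  have hx : x * c D.tPlus ^ n = d r := by
    apply Subtype.ext
    change (x : D.UniformCompletion) * D.toUniformCompletion _ ^ n = algebraMap _ _ r
    rw [← hr, toUniformCompletion_tPlus, map_pow]
  have h1 : ∀ f : powerBoundedSubring D.UniformCompletion →+* almostElements p ϖ hϖ,
      (∀ a : A₀, f (toPowerBoundedUniformCompletion D a) =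
        toAlmostElements p ϖ hϖ (algebraMap A₀ S a)) →
      (f x : TateRing S (ϖ 0)) * tateMap hϖπ (D.tPlus : TateRing A₀ π) ^ n = f (d r) := by
    intro f hf
    have h2 : f x * f (c D.tPlus) ^ n = f (d r) := by rw [← map_pow f, ← map_mul f, hx]
    rw [← hc f hf]
    exact congrArg Subtype.val h2
  refine ((D.isUnit_tPlus.map (tateMap hϖπ)).pow n).mul_right_cancel ?_
  rw [h1 f hf', h1 g hg', hd]

end Main

end

theorem proposition4p1 (p : ℕ) [Fact p.Prime]
    {A₀ : Type*} [CommRing A₀] (π : A₀)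
    (D : UniformizationData (TateRing A₀ π))
    {S : Type*} [CommRing S] [Algebra A₀ S]
    (hπ : algebraMap A₀ S π ≠ 0)
    (hS : IsIntegralPerfectoid p (algebraMap A₀ S π))
    (ϖ : ℕ → S) (hϖ : IsPowerRootSequence p ϖ)
    (hϖπ : Associated (ϖ 0) (algebraMap A₀ S π)) :
    ∃! f : powerBoundedSubring D.UniformCompletion →+* almostElements p ϖ hϖ,
      Continuous f ∧
        ∀ a : A₀, f (toPowerBoundedUniformCompletion D a) =
          toAlmostElements p ϖ hϖ (algebraMap A₀ S a) := by
  obtain ⟨F, hF, hF'⟩ := exists_uniformCompletion_extension D hS hϖ hϖπ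
  refine ⟨(F.comp (powerBoundedSubring D.UniformCompletion).subtype).codRestrict
    (almostElements p ϖ hϖ) fun x => hS.extension_mem D hϖ hϖπ F hF hF' x.2, ⟨?_, fun a => ?_⟩, ?_⟩
  · exact ((continuous_of_forall_mem D hS hϖ hϖπ F hF hF').comp
      continuous_subtype_val).subtype_mk _
  · apply Subtype.ext
    exact (hF _).trans (tateMap_algebraMap hϖπ a)
  · rintro g ⟨hg, hg'⟩
    refine hS.eq_of_continuous D hϖ hϖπ hg ?_ hg' fun a => ?_
    · exact ((continuous_of_forall_mem D hS hϖ hϖπ F hF hF').comp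
        continuous_subtype_val).subtype_mk _
    · apply Subtype.ext
      exact (hF _).trans (tateMap_algebraMap hϖπ a)
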